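/- **Definitions.** A (real, unital) Jordan algebra $(E,*,1)$ is a real unital commutative, possibly non-associative algebra with $(a*b)*(a*a)=a*(b*(a*a))$. A *Euclidean Jordan algebra* (EJA), possibly infinite-dimensional, is a Jordan algebra with an inner product that makes $E$ a real Hilbert space and satisfies $\langle a*b,c\rangle=\langle b,a*c\rangle$ for all $a,b,c$. Write $a\ge 0$ ($a$ is *positive*) if $a=b*b$ for some $b\in E$, and $c\le a$ if $a-c\ge 0$. A *state* is a linear map $\omega:E\to\mathbb R$ with $\omega(1)=1$ and $\omega(a)\ge0$ for all $a\ge0$; it is *normal* if it preserves suprema of nonempty bounded upward directed sets. An *idempotent* is a $p$ with $p*p=p$; it is *atomic* if $p\neq0$ and no nonzero idempotent lies strictly below $p$. Idempotents $p,q$ are *orthogonal* if $p*q=0$. A (unital) *JB-algebra* is a Jordan algebra with a complete norm satisfying $\|a*b\|\le\|a\|\|b\|$, $\|a^2\|=\|a\|^2$ and $\|a^2\|\le\|a^2+b^2\|$. A *JBW-algebra* is a JB-algebra in which every nonempty upward directed set that is bounded above has a supremum (*bounded directed complete*) and whose normal states separate points. It is of *type I* if below every nonzero idempotent there is an atomic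 idempotent, and of *finite rank* if the number of elements of a set of mutually orthogonal nonzero idempotents is bounded. **Theorem.** Let $(E,*,1)$ be an EJA. Sums and nonnegative multiples of positive elements are positive, and $a\ge0$, $-a\ge0$ imply $a=0$; thus the positive elements form a cone and $\le$ is a partial order. Furthermore: 1. The unit $1$ is a strong Archimedean unit: for all $a\in E$ there is $n\in\mathbb N$ with $-n1\le a\le n1$, and if $a\le\frac1n1$ for all $n\in\mathbb N$, $n\ne0$, then $a\le0$. 2. $E$ is an order unit space: $\|a\|:=\inf\{r\ge 0 : -r1\le a\le r1\}$ is a norm, the *order unit norm*, and $a\le\|a\|1$ for all $a$. 3. The order unit norm and the Hilbert norm $\|a\|_2=\sqrt{\langle a,a\rangle}$ are equivalent (there are $c,d>0$ with $c\|a\|_2\le\|a\|\le d\|a\|_2$ for all $a$), so they induce the same topology, and $E$ is complete in the order unit norm. 4. $E$ is self-dual: $a\ge0$ if and only if $\langle a,b\rangle\ge0$ for all $b\ge0$. 5. $E$ is bounded directed complete and every state on $E$ is normal; $E$ with the order unit norm is a JBW-algebra. 6. This JBW-algebra is of type I and of finite rank, and $1$ is a sum of finitely many mutually orthogonal atomic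 idempotents. -/

import Mathlib

/-- A (real, unital) Jordan algebra: a real vector space with a commutative, bilinear, unital,
possibly non-associative product satisfying the Jordan identity
`(a * b) * (a * a) = a * (b * (a * a))` (this is Mathlib's `IsCommJordan`). -/
class RealJordanAlgebra (E : Type*) [AddCommGroup E] [Module ℝ E] extends
    CommMagma E, MulOneClass E, IsCommJordan E where
  mul_add' : ∀ a b c : E, a * (b + c) = a * b + a * c
  smul_mul' : ∀ (r : ℝ) (a b : E), (r • a) * b = r • (a * b)

/-- A Euclidean Jordan algebra, possibly infinite-dimensional: a real unital Jordan algebra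
whose underlying vector space is a real Hilbert space, with `⟨a * b, c⟩ = ⟨b, a * c⟩`. -/
class EuclideanJordanAlgebra (E : Type*) [NormedAddCommGroup E] [InnerProductSpace ℝ E]
    [CompleteSpace E] [RealJordanAlgebra E] : Prop where
  inner_mul : ∀ a b c : E, inner ℝ (a * b) c = inner ℝ b (a * c)

namespace RealJordanAlgebra

section Order

variable {E : Type*} [AddCommGroup E] [Module ℝ E] [RealJordanAlgebra E]

/-- An element is positive when it is a square. -/
def Positive (a : E) : Prop := ∃ b : E, a = b * b

/-- `a ≤ b` means that `b - a` is positive. No order axioms are assumed. -/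
instance instLE : LE E := ⟨fun a b => Positive (b - a)⟩

theorem le_def (a b : E) : a ≤ b ↔ ∃ c : E, b - a = c * c := Iff.rfl

theorem nonneg_iff (a : E) : 0 ≤ a ↔ ∃ c : E, a = c * c := by
  rw [le_def, sub_zero]

/-- The order unit (semi)norm `inf {r ≥ 0 ; -r1 ≤ a ≤ r1}`. -/
noncomputable def orderUnitNorm (a : E) : ℝ :=
  sInf {r : ℝ | 0 ≤ r ∧ -(r • (1 : E)) ≤ a ∧ a ≤ r • (1 : E)}

/-- A state: a positive unital linear functional (no continuity is assumed). -/
structure IsState (ω : E →ₗ[ℝ] ℝ) : Prop where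
  nonneg : ∀ a : E, 0 ≤ a → 0 ≤ ω a
  map_one : ω 1 = 1

/-- A functional is normal when it preserves suprema of (nonempty) bounded directed sets. -/
def IsNormal (ω : E →ₗ[ℝ] ℝ) : Prop :=
  ∀ (S : Set E) (a : E), S.Nonempty → DirectedOn (· ≤ ·) S → IsLUB S a → IsLUB (ω '' S) (ω a)

/-- An atomic idempotent: a nonzero idempotent with no nonzero idempotent strictly below it. -/
structure IsAtomic (p : E) : Prop where
  idem : IsIdempotentElem p
  ne_zero : p ≠ 0
  minimal : ∀ q : E, IsIdempotentElem q → q ≠ 0 → q ≤ p → q = p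

variable (E)

/-- Every nonempty directed subset that is bounded above has a supremum. -/
def BoundedDirectedComplete : Prop :=
  ∀ S : Set E, S.Nonempty → DirectedOn (· ≤ ·) S → BddAbove S → ∃ a : E, IsLUB S a

/-- Type I: below every nonzero idempotent there is an atomic idempotent. -/
def IsTypeI : Prop :=
  ∀ p : E, IsIdempotentElem p → p ≠ 0 → ∃ q : E, IsAtomic q ∧ q ≤ p

/-- Finite rank: there is a bound on the number of mutually orthogonal nonzero idempotents. -/
def HasFiniteRank : Prop :=
  ∃ N : ℕ, ∀ F : Finset E, (∀ p ∈ F, IsIdempotentElem p ∧ p ≠ 0) →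
    (∀ p ∈ F, ∀ q ∈ F, p ≠ q → p * q = 0) → F.card ≤ N

end Order

/-- `N` is a norm on the real vector space `E`. -/
structure IsNormOn {E : Type*} [AddCommGroup E] [Module ℝ E] (N : E → ℝ) : Prop where
  nonneg : ∀ a : E, 0 ≤ N a
  eq_zero_iff : ∀ a : E, N a = 0 ↔ a = 0
  smul : ∀ (r : ℝ) (a : E), N (r • a) = |r| * N a
  triangle : ∀ a b : E, N (a + b) ≤ N a + N b

/-- Every sequence that is Cauchy for `N` converges for `N`. -/
def IsCompleteFor {E : Type*} [AddCommGroup E] (N : E → ℝ) : Prop :=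
  ∀ u : ℕ → E,
    (∀ ε : ℝ, 0 < ε → ∃ K : ℕ, ∀ m n : ℕ, K ≤ m → K ≤ n → N (u m - u n) < ε) →
    ∃ l : E, ∀ ε : ℝ, 0 < ε → ∃ K : ℕ, ∀ n : ℕ, K ≤ n → N (u n - l) < ε

variable {E : Type*} [AddCommGroup E] [Module ℝ E] [RealJordanAlgebra E]

/-- `E` with the norm `N` is a (unital) JB-algebra. -/
structure IsJBAlgebra (N : E → ℝ) : Prop where
  isNorm : IsNormOn N
  complete : IsCompleteFor N
  norm_mul_le : ∀ a b : E, N (a * b) ≤ N a * N b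
  norm_sq : ∀ a : E, N (a * a) = N a ^ 2
  norm_sq_le : ∀ a b : E, N (a * a) ≤ N (a * a + b * b)

/-- `E` with the norm `N` is a JBW-algebra: a JB-algebra that is bounded directed complete and
whose normal states separate its points. -/
structure IsJBWAlgebra (N : E → ℝ) : Prop extends IsJBAlgebra N where
  directedComplete : BoundedDirectedComplete E
  separating : ∀ a b : E, a ≠ b → ∃ ω : E →ₗ[ℝ] ℝ, IsState ω ∧ IsNormal ω ∧ ω a ≠ ω b

end RealJordanAlgebra

/-! Everything rests on a spectral theorem with finitely many terms. Multiplication operators are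
symmetric and everywhere defined, hence bounded, and uniform boundedness gives `‖a * b‖ ≤ C * ‖a‖ *
‖b‖`. Applied to `p * p = p`, this bounds the norm of every nonzero idempotent from below. As
squared norms of orthogonal idempotents add up, splitting idempotents off `1` must stop; this is the
substitute for finite dimension.

Idempotents come from the closed subalgebra generated by `a`, which is associative by power
associativity and continuity. For `b ≠ 0` in it, scaled to operator norm one, the even powers
converge to a nonzero idempotent (`exists_idempotent_of_norm_eq_one`), from which an idempotent
eigenvector of `b` is cut. Peeling these off gives `exists_spectral`.

Positivity now means nonnegative eigenvalues. The Peirce identity gives `⟨p, q⟩ ≥ 0` for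
idempotents, so the cone is self-dual (`nonneg_iff_inner`), hence convex and closed. The order unit
norm is the largest absolute eigenvalue. On the cone the Hilbert norm is controlled by `⟨1, a⟩`, so
a bounded directed set contains a sequence converging to its supremum, and states, being continuous,
preserve that supremum. -/

namespace RealJordanAlgebra

/-! ### Linearised Jordan identity and power associativity -/

section Algebra

variable {E : Type*} [AddCommGroup E] [Module ℝ E] [RealJordanAlgebra E]

/-- Multiplication of a real Jordan algebra as a bilinear map. -/
def lmul : E →ₗ[ℝ] E →ₗ[ℝ] E :=
  LinearMap.mk₂ ℝ (fun a b => a * b)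
    (fun a b c => by rw [mul_comm, mul_add', mul_comm c, mul_comm c])
    (fun r a b => smul_mul' r a b)
    (fun a b c => mul_add' a b c)
    (fun r a b => by rw [mul_comm, smul_mul', mul_comm])

@[simp] theorem lmul_apply (a b : E) : lmul a b = a * b := rfl

theorem jmul_add (a b c : E) : a * (b + c) = a * b + a * c := mul_add' a b c

theorem jadd_mul (a b c : E) : (a + b) * c = a * c + b * c := by
  simp [← lmul_apply]

theorem jmul_sub (a b c : E) : a * (b - c) = a * b - a * c := map_sub (lmul a) b c

theorem jsub_mul (a b c : E) : (a - b) * c = a * c - b * c := by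
  simp [← lmul_apply]

theorem jsmul_mul (r : ℝ) (a b : E) : (r • a) * b = r • (a * b) := smul_mul' r a b

theorem jmul_smul (r : ℝ) (a b : E) : a * (r • b) = r • (a * b) := map_smul (lmul a) r b

theorem jmul_zero (a : E) : a * 0 = 0 := map_zero (lmul a)

theorem jzero_mul (a : E) : 0 * a = 0 := by rw [mul_comm, jmul_zero]

theorem jneg_mul (a b : E) : (-a) * b = -(a * b) := by simp [← lmul_apply]

theorem jmul_sum {ι : Type*} (a : E) (s : Finset ι) (f : ι → E) :
    a * ∑ i ∈ s, f i = ∑ i ∈ s, a * f i := map_sum (lmul a) f s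

theorem jsum_mul {ι : Type*} (a : E) (s : Finset ι) (f : ι → E) :
    (∑ i ∈ s, f i) * a = ∑ i ∈ s, f i * a := by
  simp_rw [mul_comm _ a, jmul_sum]

theorem jordan (a b : E) : (a * b) * (a * a) = a * (b * (a * a)) := IsCommJordan.lmul_comm_rmul_rmul a b

/-- The fully linearised Jordan identity. -/
theorem jordan_linearized (x a c d : E) :
    (a * x) * (c * d) + (c * x) * (d * a) + (d * x) * (a * c) =
      a * (x * (c * d)) + c * (x * (d * a)) + d * (x * (a * c)) := by
  have h1 := jordan (a + c + d) x
  have h2 := jordan (a + c) x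
  have h3 := jordan (a + d) x
  have h4 := jordan (c + d) x
  have h5 := jordan a x
  have h6 := jordan c x
  have h7 := jordan d x
  simp only [jmul_add, jadd_mul] at h1 h2 h3 h4
  rw [mul_comm d c, mul_comm d a, mul_comm c a] at *
  -- Inclusion–exclusion isolates the part trilinear in `a`, `c`, `d`; by commutativity each term
  -- occurs twice.
  linear_combination (norm := module) (1 / 2 : ℝ) • (h1 - h2 - h3 - h4 + h5 + h6 + h7)

/-- Exchanging `a` and `x` in the linearised identity expresses multiplication by a triple product
through multiplications by shorter ones; this drives the induction on powers. -/
theorem mul_mul_mul_eq (x a c d : E) :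
    (a * (c * d)) * x = (c * d) * (a * x) + (d * a) * (c * x) + (a * c) * (d * x)
      - c * (a * (d * x)) - d * (a * (c * x)) := by
  have h := jordan_linearized a x c d
  have h1 : x * (a * (c * d)) = (a * (c * d)) * x := mul_comm _ _
  have h2 : (x * a) * (c * d) = (c * d) * (a * x) := by rw [mul_comm x a, mul_comm]
  have h3 : (c * a) * (d * x) = (a * c) * (d * x) := by rw [mul_comm c a]
  have h4 : (d * a) * (x * c) = (d * a) * (c * x) := by rw [mul_comm x c]
  rw [h1, h2, h3, h4, mul_comm x c] at h
  linear_combination (norm := module) -h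

/-- The Peirce identity for left multiplication by an idempotent. -/
theorem _root_.IsIdempotentElem.peirce {p : E} (hp : IsIdempotentElem p) (x : E) :
    p * x = (3 : ℝ) • (p * (p * x)) - (2 : ℝ) • (p * (p * (p * x))) := by
  have h := mul_mul_mul_eq x p p p
  rw [hp.eq, hp.eq] at h
  nth_rw 1 [h]
  module

/-- Evaluation of a polynomial at an element of a Jordan algebra. -/
noncomputable def jeval (a : E) : Polynomial ℝ →ₗ[ℝ] E :=
  (LinearMap.applyₗ (1 : E)).comp (Polynomial.aeval (R := ℝ) (lmul a)).toLinearMap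

theorem jeval_apply (a : E) (f : Polynomial ℝ) : jeval a f = Polynomial.aeval (lmul a) f 1 := rfl

theorem jeval_one (a : E) : jeval a 1 = 1 := by simp [jeval_apply]

theorem jeval_X (a : E) : jeval a Polynomial.X = a := by simp [jeval_apply]

theorem jeval_X_pow_succ (a : E) (n : ℕ) :
    jeval a (Polynomial.X ^ (n + 1)) = a * jeval a (Polynomial.X ^ n) := by
  simp [jeval_apply, pow_succ']

/-- Multiplication by `a * (a * u)` is a polynomial in the multiplications by `a`, `a * a`, `u` and
`a * u`. That by `a * a` commutes with that by `a` by the Jordan identity, the last two by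
induction. -/
theorem mul_jeval_X_pow_mul (a : E) (n : ℕ) : ∀ x,
    a * (jeval a (Polynomial.X ^ n) * x) = jeval a (Polynomial.X ^ n) * (a * x) := by
  induction n using Nat.strong_induction_on with
  | _ n ih =>
    match n, ih with
    | 0, _ => intro x; rw [pow_zero, jeval_one, one_mul, one_mul]
    | 1, _ => intro x; rw [pow_one, jeval_X]
    | n + 2, ih =>
      intro x
      have h0 := ih n (by omega)
      have h1 := ih (n + 1) (by omega)
      have h2 : ∀ y, a * ((a * a) * y) = (a * a) * (a * y) := fun y => by
        rw [mul_comm (a * a) (a * y), jordan, mul_comm y]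
      rw [jeval_X_pow_succ, jeval_X_pow_succ] at *
      set u := jeval a (Polynomial.X ^ n)
      have h3 := fun y => mul_mul_mul_eq y a a u
      rw [mul_comm u a] at h3
      rw [h3, h3]
      simp only [jmul_add, jmul_sub, h0, h1, h2]

theorem commute_lmul_jeval (a : E) (f : Polynomial ℝ) :
    Commute (lmul (jeval a f)) (lmul a) := by
  induction f using Polynomial.induction_on' with
  | add f g hf hg => simpa only [map_add] using hf.add_left hg
  | monomial n r =>
    rw [← Polynomial.smul_X_eq_monomial, map_smul, map_smul]
    refine Commute.smul_left ?_ r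
    ext x
    exact (mul_jeval_X_pow_mul a n x).symm

/-- Power associativity: multiplication by `f(a)` commutes with that by `a`, hence with every
polynomial in it; evaluate at `1`. -/
theorem jeval_mul (a : E) (f g : Polynomial ℝ) : jeval a (f * g) = jeval a f * jeval a g := by
  have h : Commute (lmul (jeval a f)) (Polynomial.aeval (lmul a) g) := by
    induction g using Polynomial.induction_on' with
    | add g k hg hk => simpa only [map_add] using hg.add_right hk
    | monomial n r =>
      rw [Polynomial.aeval_monomial]
      exact (Algebra.commute_algebraMap_right r _).mul_right
        ((commute_lmul_jeval a f).pow_right n)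
  have h1 := LinearMap.congr_fun h.eq 1
  simp only [Module.End.mul_apply, lmul_apply, mul_one] at h1
  rw [jeval_apply a g, h1, mul_comm, jeval_apply, jeval_apply, map_mul]
  rfl

end Algebra

/-! ### Bounded multiplication and the closed subalgebra generated by an element -/

section Hilbert

variable {E : Type*} [NormedAddCommGroup E] [InnerProductSpace ℝ E]
    [CompleteSpace E] [RealJordanAlgebra E] [EuclideanJordanAlgebra E]

theorem inner_mul_left (a b c : E) : inner ℝ (a * b) c = inner ℝ b (a * c) :=
  EuclideanJordanAlgebra.inner_mul a b c

theorem inner_mul_eq_inner_one (a b : E) : inner ℝ a b = inner ℝ (1 : E) (a * b) := by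
  rw [← inner_mul_left, mul_one]

variable (E) in
/-- Multiplication in a Euclidean Jordan algebra is bounded, although this is not assumed. -/
theorem exists_norm_mul_le : ∃ C : ℝ, 0 < C ∧ ∀ a b : E, ‖a * b‖ ≤ C * ‖a‖ * ‖b‖ := by
  -- Hellinger–Toeplitz: a symmetric operator defined on all of a Hilbert space is bounded.
  have hc : ∀ a : E, Continuous (lmul a) := fun a =>
    LinearMap.IsSymmetric.continuous (T := lmul a) fun x y => inner_mul_left a x y
  let g : Metric.closedBall (0 : E) 1 → E →L[ℝ] E := fun a => ⟨lmul a.1, hc a.1⟩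
  -- By commutativity the operator of `b` bounds `a * b` uniformly over the unit ball of `a`.
  obtain ⟨C, hC⟩ := banach_steinhaus (g := g) fun b => by
    refine ⟨‖(⟨lmul b, hc b⟩ : E →L[ℝ] E)‖, fun a => ?_⟩
    have h1 : g a b = (⟨lmul b, hc b⟩ : E →L[ℝ] E) a := mul_comm _ _
    rw [h1]
    refine (ContinuousLinearMap.le_opNorm _ _).trans ?_
    exact mul_le_of_le_one_right (norm_nonneg _) (mem_closedBall_zero_iff.1 a.2)
  have hC0 : 0 ≤ C := (norm_nonneg _).trans (hC ⟨0, by simp⟩)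
  refine ⟨C + 1, by linarith, fun a b => ?_⟩
  rcases eq_or_ne a 0 with rfl | ha
  · simp [jzero_mul]
  have ha' : 0 < ‖a‖ := norm_pos_iff.2 ha
  have hmem : ‖a‖⁻¹ • a ∈ Metric.closedBall (0 : E) 1 := by
    rw [mem_closedBall_zero_iff, norm_smul, norm_inv, norm_norm, inv_mul_cancel₀ ha'.ne']
  have h2 : ‖(‖a‖⁻¹ • a) * b‖ ≤ C * ‖b‖ :=
    (ContinuousLinearMap.le_opNorm (g ⟨_, hmem⟩) b).trans
      (mul_le_mul_of_nonneg_right (hC _) (norm_nonneg _))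
  rw [jsmul_mul, norm_smul, norm_inv, norm_norm, inv_mul_le_iff₀ ha'] at h2
  nlinarith [mul_nonneg ha'.le (norm_nonneg b)]

theorem continuous_jmul : Continuous fun x : E × E => x.1 * x.2 := by
  obtain ⟨C, -, hC⟩ := exists_norm_mul_le E
  exact (LinearMap.mkContinuous₂ (lmul (E := E)) C hC).continuous₂

theorem continuous_mul_jleft (a : E) : Continuous fun x : E => a * x :=
  continuous_jmul.comp (by fun_prop : Continuous fun x : E => (a, x))

omit [CompleteSpace E] [RealJordanAlgebra E] [EuclideanJordanAlgebra E] in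
theorem norm_inv_norm_smul (T : E →L[ℝ] E) (hT : T ≠ 0) : ‖‖T‖⁻¹ • T‖ = 1 := by
  rw [norm_smul, norm_inv, norm_norm, inv_mul_cancel₀ (norm_ne_zero_iff.2 hT)]

/-- The closed subalgebra generated by an element. -/
noncomputable def closedAdjoin (a : E) : Submodule ℝ E :=
  (LinearMap.range (jeval a)).topologicalClosure

omit [CompleteSpace E] [EuclideanJordanAlgebra E] in
theorem jeval_mem_closedAdjoin (a : E) (f : Polynomial ℝ) : jeval a f ∈ closedAdjoin a :=
  Submodule.le_topologicalClosure _ ⟨f, rfl⟩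

omit [CompleteSpace E] [EuclideanJordanAlgebra E] in
theorem isClosed_closedAdjoin (a : E) : IsClosed (closedAdjoin a : Set E) :=
  Submodule.isClosed_topologicalClosure _

omit [CompleteSpace E] [EuclideanJordanAlgebra E] in
theorem closedAdjoin_induction (a : E) {P : E → Prop} (hP : IsClosed {x | P x})
    (h : ∀ f, P (jeval a f)) : ∀ x ∈ closedAdjoin a, P x := by
  intro x hx
  have h1 : closure (LinearMap.range (jeval a) : Set E) ⊆ {x | P x} :=
    closure_minimal (by rintro _ ⟨f, rfl⟩; exact h f) hP
  exact h1 hx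

theorem mul_mem_closedAdjoin (a : E) : ∀ x ∈ closedAdjoin a, ∀ y ∈ closedAdjoin a,
    x * y ∈ closedAdjoin a := by
  intro x hx
  refine closedAdjoin_induction a ((isClosed_closedAdjoin a).preimage (continuous_mul_jleft x))
    fun g => ?_
  revert x hx
  simp_rw [mul_comm _ (jeval a g)]
  refine closedAdjoin_induction a ((isClosed_closedAdjoin a).preimage (continuous_mul_jleft _))
    fun f => ?_
  rw [← jeval_mul]
  exact jeval_mem_closedAdjoin a _

theorem mul_assoc_closedAdjoin (a : E) : ∀ x ∈ closedAdjoin a, ∀ y ∈ closedAdjoin a,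
    ∀ z ∈ closedAdjoin a, x * (y * z) = (x * y) * z := by
  have hc : ∀ {f g : E → E}, Continuous f → Continuous g → Continuous fun x => f x * g x :=
    fun hf hg => continuous_jmul.comp (hf.prodMk hg)
  have hi := continuous_id (X := E)
  intro x hx y hy
  refine closedAdjoin_induction a
    (isClosed_eq (hc continuous_const (hc continuous_const hi)) (hc continuous_const hi))
    fun h => ?_
  revert y hy
  refine closedAdjoin_induction a
    (isClosed_eq (hc continuous_const (hc hi continuous_const))
      (hc (hc continuous_const hi) continuous_const)) fun g => ?_
  revert x hx
  refine closedAdjoin_induction a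
    (isClosed_eq (hc hi continuous_const) (hc (hc hi continuous_const) continuous_const))
    fun f => ?_
  simp only [← jeval_mul, mul_assoc]

/-- Power iteration: under the even powers of a self-adjoint contraction only the spectral values
`1` and `-1` survive. Here `T ^ n` is multiplication by `v n`, the `n`th power of `b`, so the limit
is an element of the algebra. -/
theorem exists_idempotent_of_norm_eq_one {A : Submodule ℝ E} (hA : IsClosed (A : Set E))
    (h1 : (1 : E) ∈ A) (hassoc : ∀ x ∈ A, ∀ y ∈ A, ∀ z ∈ A, x * (y * z) = (x * y) * z)
    {b : E} (hb : b ∈ A) (T : A →L[ℝ] A) (hT : ∀ x, (T x : E) = b * x) (hn : ‖T‖ = 1) :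
    ∃ p ∈ A, IsIdempotentElem p ∧ p ≠ 0 ∧ b * (b * p) = p := by
  obtain ⟨C, hC0, hC⟩ := exists_norm_mul_le E
  have : CompleteSpace A := hA.completeSpace_coe
  have hsa : IsSelfAdjoint T := by
    rw [ContinuousLinearMap.isSelfAdjoint_iff_isSymmetric]
    intro x y
    have := inner_mul_left b (x : E) (y : E)
    simpa [Submodule.coe_inner, hT] using this
  set v : ℕ → A := fun n => (T ^ n) ⟨1, h1⟩ with hv
  have hTv : ∀ n, T (v n) = v (n + 1) := fun n => by
    simp only [hv, pow_succ']
    rfl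
  have hpow : ∀ n x, ((T ^ n) x : E) = v n * x := by
    intro n x
    induction n with
    | zero => simp [hv]
    | succ n ih =>
      rw [pow_succ', mul_apply_eq_comp, hT, ih, hassoc _ hb _ (v n).2 _ x.2,
        ← hTv, hT]
  have hmul : ∀ m n, (v m : E) * v n = v (m + n) := fun m n => by
    rw [← hpow, hv]; simp [pow_add]
  have hinner : ∀ i j, inner ℝ (v i) (v j) = inner ℝ (v 0) (v (i + j)) := fun i j => by
    have h := (ContinuousLinearMap.isSelfAdjoint_iff_isSymmetric.1 (hsa.pow i)) (v 0) (v j)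
    have h2 : v (i + j) = (T ^ i) (v j) := by
      simp only [hv, pow_add]
      rfl
    rw [h2]
    exact h
  have hinner2 : ∀ m n, inner ℝ (v (2 * m)) (v (2 * n)) = ‖v (m + n)‖ ^ 2 := fun m n => by
    rw [← real_inner_self_eq_norm_sq, hinner, hinner (m + n)]
    congr 2; ring
  have hanti : Antitone fun n => ‖v n‖ ^ 2 := antitone_nat_of_succ_le fun n => by
    rw [← hTv]
    gcongr
    simpa [hn] using T.le_opNorm (v n)
  obtain ⟨s, hs⟩ : ∃ s, Filter.Tendsto (fun n => ‖v n‖ ^ 2) Filter.atTop (nhds s) :=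
    ⟨_, tendsto_atTop_ciInf hanti ⟨0, by rintro _ ⟨n, rfl⟩; positivity⟩⟩
  have hge : ∀ n, s ≤ ‖v n‖ ^ 2 := fun n => hanti.le_of_tendsto hs n
  -- The squared distance of two terms is `‖v (2n)‖² + ‖v (2N)‖² - 2‖v (n + N)‖²`, and the
  -- decreasing squared norms tend to `s`.
  have hcauchy : CauchySeq fun n => v (2 * n) := by
    refine Metric.cauchySeq_iff'.2 fun ε hε => ?_
    obtain ⟨N, hN⟩ := Filter.eventually_atTop.1
      (hs.eventually (gt_mem_nhds (show s < s + ε ^ 2 / 2 by linarith [pow_pos hε 2])))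
    refine ⟨N, fun n hnN => ?_⟩
    rw [dist_eq_norm]
    refine lt_of_pow_lt_pow_left₀ 2 hε.le ?_
    rw [norm_sub_sq_real, ← real_inner_self_eq_norm_sq, ← real_inner_self_eq_norm_sq,
      hinner2, hinner2, hinner2]
    have h1 := hN (n + n) (by omega)
    have h2 := hN (N + N) (by omega)
    have h3 := hge (n + N)
    linarith
  obtain ⟨p, hp⟩ := cauchySeq_tendsto_of_complete hcauchy
  have hpE : Filter.Tendsto (fun n => (v (2 * n) : E)) Filter.atTop (nhds (p : E)) :=
    (continuous_subtype_val.tendsto p).comp hp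
  refine ⟨p, p.2, ?_, ?_, ?_⟩
  · have h2 : Filter.Tendsto (fun n => (v (2 * n) : E) * v (2 * n)) Filter.atTop
        (nhds ((p : E) * p)) :=
      (continuous_jmul.tendsto ((p : E), (p : E))).comp (hpE.prodMk_nhds hpE)
    refine tendsto_nhds_unique h2 ?_
    have h3 : Filter.Tendsto (fun n : ℕ => 2 * n) Filter.atTop Filter.atTop :=
      Filter.tendsto_id.const_mul_atTop' (by norm_num)
    refine (hpE.comp h3).congr fun n => ?_
    rw [hmul, Function.comp_apply, two_mul (2 * n)]
  -- Self-adjointness keeps `‖T ^ 2 ^ k‖ = 1`, while `T ^ m` is multiplication by `v m`, so its norm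
  -- is at most `C * ‖v m‖`; the limit cannot vanish.
  · have hlow : ∀ n, 1 ≤ C * ‖(v (2 * 2 ^ n) : E)‖ := fun n => by
      have h2 : ‖T ^ 2 ^ (n + 1)‖ = 1 := by
        have := IsSelfAdjoint.nnnorm_pow_two_pow (E := A →L[ℝ] A) hsa (n + 1)
        have h := congrArg NNReal.toReal this
        simpa [hn] using h
      rw [← h2, ← pow_succ']
      refine ContinuousLinearMap.opNorm_le_bound _ (by positivity) fun x => ?_
      have := hC (v (2 ^ (n + 1))) x
      rw [← hpow] at this
      exact this
    have h3 : Filter.Tendsto (fun n : ℕ => 2 ^ n) Filter.atTop Filter.atTop :=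
      tendsto_pow_atTop_atTop_of_one_lt (by norm_num)
    have h4 : 1 ≤ C * ‖(p : E)‖ :=
      ge_of_tendsto' ((hpE.comp h3).norm.const_mul C) hlow
    intro h0
    rw [h0] at h4
    simp at h4
    linarith
  · have h2 : Filter.Tendsto (fun n => b * (b * (v (2 * n) : E))) Filter.atTop
        (nhds (b * (b * (p : E)))) :=
      (((continuous_mul_jleft b).comp (continuous_mul_jleft b)).tendsto _).comp hpE
    refine tendsto_nhds_unique h2 ?_
    refine (hpE.comp (Filter.tendsto_add_atTop_nat 1)).congr fun n => ?_
    rw [← hT, ← hT, hTv, hTv]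
    rfl

theorem exists_idempotent_eigenvector {A : Submodule ℝ E} (hA : IsClosed (A : Set E))
    (h1 : (1 : E) ∈ A) (hm : ∀ x ∈ A, ∀ y ∈ A, x * y ∈ A)
    (hassoc : ∀ x ∈ A, ∀ y ∈ A, ∀ z ∈ A, x * (y * z) = (x * y) * z)
    {b : E} (hb : b ∈ A) (hb0 : b ≠ 0) :
    ∃ p ∈ A, IsIdempotentElem p ∧ p ≠ 0 ∧ ∃ l : ℝ, l ≠ 0 ∧ b * p = l • p := by
  let T : A →L[ℝ] A :=
    ⟨(lmul b).restrict (fun x hx => hm b hb x hx),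
      ((continuous_mul_jleft b).comp continuous_subtype_val).subtype_mk _⟩
  have hT : ∀ x, (T x : E) = b * x := fun x => rfl
  have hT0 : T ≠ 0 := fun h => hb0 (by
    have := hT ⟨1, h1⟩
    rw [h] at this
    simpa using this.symm)
  set r := ‖T‖ with hr
  have hr0 : r ≠ 0 := fun h => hT0 ((ContinuousLinearMap.opNorm_zero_iff T).1 h)
  have hcA : r⁻¹ • b ∈ A := A.smul_mem _ hb
  obtain ⟨p, hpA, hpi, hp0, hp⟩ := exists_idempotent_of_norm_eq_one hA h1 hassoc
    hcA (r⁻¹ • T) (fun x => by simp [hT, jsmul_mul])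
    (norm_inv_norm_smul T hT0)
  set c := r⁻¹ • b with hc
  have hbc : b = r • c := by rw [hc, smul_smul, mul_inv_cancel₀ hr0, one_smul]
  have hcp : c * p ∈ A := hm _ hcA _ hpA
  have hcpp : (c * p) * p = c * p := by rw [← hassoc _ hcA _ hpA _ hpA, hpi.eq]
  have hcpcp : (c * p) * (c * p) = p := by
    rw [hassoc _ hcp _ hcA _ hpA, mul_comm (c * p) c, hp, hpi.eq]
  -- As `(c * p) * (c * p) = p`, the elements `(p ± c * p) / 2` are idempotent eigenvectors of `c`
  -- for `±1`; their sum is `p ≠ 0`, so one of them is nonzero.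
  have key : ∀ e : ℝ, e ^ 2 = 1 → p + e • (c * p) ≠ 0 →
      ∃ p ∈ A, IsIdempotentElem p ∧ p ≠ 0 ∧ ∃ l : ℝ, l ≠ 0 ∧ b * p = l • p := by
    intro e he hne
    have he0 : e ≠ 0 := by rintro rfl; norm_num at he
    refine ⟨(1 / 2 : ℝ) • (p + e • (c * p)),
      A.smul_mem _ (A.add_mem hpA (A.smul_mem _ hcp)), ?_, ?_, r * e, mul_ne_zero hr0 he0, ?_⟩
    · rw [IsIdempotentElem]
      simp only [jsmul_mul, jmul_smul, jmul_add, jadd_mul, hcpp, hcpcp, hpi.eq,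
        mul_comm p (c * p), smul_smul, smul_add]
      rw [show (1 / 2 * e * (1 / 2 * e) : ℝ) = 1 / 4 by linear_combination he / 4]
      module
    · exact smul_ne_zero (by norm_num) hne
    · rw [hbc]
      simp only [jsmul_mul, jmul_smul, jmul_add, hp, smul_smul, smul_add]
      rw [show r * e * (1 / 2 * e) = r * (1 / 2) by linear_combination r / 2 * he]
      module
  by_cases h : p + (1 : ℝ) • (c * p) = 0
  · refine key (-1) (by norm_num) fun h' => hp0 ?_
    linear_combination (norm := module) (1 / 2 : ℝ) • (h + h')
  · exact key 1 (by norm_num) h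

end Hilbert

/-! ### Orthogonal systems of idempotents -/

section Algebra

variable {E : Type*} [AddCommGroup E] [Module ℝ E] [RealJordanAlgebra E]

/-- A finite set of nonzero, mutually orthogonal idempotents. -/
structure IsOrthogonalSystem (F : Finset E) : Prop where
  idem : ∀ p ∈ F, IsIdempotentElem p
  ne_zero : ∀ p ∈ F, p ≠ 0
  orth : ∀ p ∈ F, ∀ q ∈ F, p ≠ q → p * q = 0

theorem IsOrthogonalSystem.sum_smul_mul {F : Finset E} (hF : IsOrthogonalSystem F) (l : E → ℝ)
    {q : E} (hq : q ∈ F) : (∑ p ∈ F, l p • p) * q = l q • q := by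
  rw [jsum_mul, Finset.sum_eq_single_of_mem q hq, jsmul_mul, (hF.idem q hq).eq]
  intro p hp hpq
  rw [jsmul_mul, hF.orth p hp q hq hpq, smul_zero]

theorem IsOrthogonalSystem.sum_mul {F : Finset E} (hF : IsOrthogonalSystem F)
    {q : E} (hq : q ∈ F) : (∑ p ∈ F, p) * q = q := by
  simpa using hF.sum_smul_mul (fun _ => 1) hq

theorem IsOrthogonalSystem.sum_smul_mul_sum_smul {F : Finset E} (hF : IsOrthogonalSystem F)
    (l m : E → ℝ) : (∑ p ∈ F, l p • p) * (∑ p ∈ F, m p • p) = ∑ p ∈ F, (l p * m p) • p := by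
  rw [jmul_sum]
  refine Finset.sum_congr rfl fun q hq => ?_
  rw [jmul_smul, hF.sum_smul_mul l hq, smul_smul, mul_comm]

theorem IsOrthogonalSystem.isIdempotentElem_sum {F : Finset E} (hF : IsOrthogonalSystem F) :
    IsIdempotentElem (∑ p ∈ F, p) := by
  simpa [IsIdempotentElem] using hF.sum_smul_mul_sum_smul (fun _ => 1) (fun _ => 1)

theorem IsOrthogonalSystem.insert [DecidableEq E] {F : Finset E} (hF : IsOrthogonalSystem F)
    {q : E} (hq : IsIdempotentElem q) (hq0 : q ≠ 0) (hqF : ∀ p ∈ F, q * p = 0) :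
    q ∉ F ∧ IsOrthogonalSystem (insert q F) := by
  refine ⟨fun h => hq0 (by rw [← hq.eq, hqF q h]), ⟨?_, ?_, ?_⟩⟩
  · exact (Finset.forall_mem_insert ..).2 ⟨hq, hF.idem⟩
  · exact (Finset.forall_mem_insert ..).2 ⟨hq0, hF.ne_zero⟩
  · simp only [Finset.forall_mem_insert]
    exact ⟨⟨fun h => absurd rfl h, fun p hp _ => hqF p hp⟩,
      fun p hp => ⟨fun _ => by rw [mul_comm, hqF p hp], hF.orth p hp⟩⟩

theorem isIdempotentElem_sub {p q : E} (hp : IsIdempotentElem p) (hq : IsIdempotentElem q)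
    (h : p * q = q) : IsIdempotentElem (p - q) := by
  rw [IsIdempotentElem, jsub_mul, jmul_sub, jmul_sub, mul_comm q p, hp.eq, hq.eq, h]
  abel

theorem le_iff_sub_nonneg (a b : E) : a ≤ b ↔ 0 ≤ b - a := by rw [le_def, nonneg_iff]

theorem mul_self_nonneg' (a : E) : 0 ≤ a * a := (nonneg_iff _).2 ⟨a, rfl⟩

theorem _root_.IsIdempotentElem.nonneg' {p : E} (hp : IsIdempotentElem p) : 0 ≤ p := by
  rw [← hp.eq]
  exact mul_self_nonneg' p

theorem IsOrthogonalSystem.sum_smul_nonneg {F : Finset E} (hF : IsOrthogonalSystem F) {l : E → ℝ}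
    (hl : ∀ p ∈ F, 0 ≤ l p) : 0 ≤ ∑ p ∈ F, l p • p := by
  rw [nonneg_iff]
  refine ⟨∑ p ∈ F, √(l p) • p, ?_⟩
  rw [hF.sum_smul_mul_sum_smul]
  exact Finset.sum_congr rfl fun p hp => by rw [Real.mul_self_sqrt (hl p hp)]

theorem jle_refl (a : E) : a ≤ a := by
  rw [le_iff_sub_nonneg, sub_self, nonneg_iff]
  exact ⟨0, (jmul_zero 0).symm⟩

theorem jneg_le_neg {a b : E} (h : a ≤ b) : -b ≤ -a := by
  rw [le_iff_sub_nonneg] at *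
  rwa [neg_sub_neg]

theorem one_nonneg' : (0 : E) ≤ 1 := IsIdempotentElem.nonneg' (mul_one 1)

end Algebra

/-! ### The spectral theorem -/

section Hilbert

variable {E : Type*} [NormedAddCommGroup E] [InnerProductSpace ℝ E]
    [CompleteSpace E] [RealJordanAlgebra E] [EuclideanJordanAlgebra E]

variable (E) in
theorem exists_one_le_norm_idempotent :
    ∃ C : ℝ, 0 < C ∧ ∀ p : E, IsIdempotentElem p → p ≠ 0 → 1 ≤ C * ‖p‖ ^ 2 := by
  obtain ⟨C, hC, h⟩ := exists_norm_mul_le E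
  refine ⟨C ^ 2, by positivity, fun p hp h0 => ?_⟩
  have h1 := h p p
  rw [hp.eq] at h1
  have h2 : 0 < ‖p‖ := norm_pos_iff.2 h0
  have h3 : 1 ≤ C * ‖p‖ := by
    by_contra! h3
    nlinarith
  nlinarith

theorem _root_.IsIdempotentElem.norm_sub_sq {p q : E} (hq : IsIdempotentElem q) (h : p * q = q) :
    ‖p - q‖ ^ 2 = ‖p‖ ^ 2 - ‖q‖ ^ 2 := by
  rw [norm_sub_sq_real, ← real_inner_self_eq_norm_sq q, inner_mul_eq_inner_one p q, h,
    inner_mul_eq_inner_one q q, hq.eq]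
  ring

/-- Each idempotent split off lowers `C * ‖q‖ ^ 2` by at least `1`, so induction on a bound for it
terminates. Staying inside `closedAdjoin a` keeps associativity available. -/
theorem exists_spectral_aux (a : E) {C : ℝ}
    (hCp : ∀ p : E, IsIdempotentElem p → p ≠ 0 → 1 ≤ C * ‖p‖ ^ 2) (n : ℕ) :
    ∀ q ∈ closedAdjoin a, IsIdempotentElem q → C * ‖q‖ ^ 2 ≤ n →
      ∃ F : Finset E, IsOrthogonalSystem F ∧ ∑ p ∈ F, p = q ∧
        ∀ p ∈ F, p ∈ closedAdjoin a ∧ ∃ l : ℝ, a * p = l • p := by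
  classical
  have h1A : (1 : E) ∈ closedAdjoin a := by
    rw [← jeval_one a]; exact jeval_mem_closedAdjoin a _
  have haA : a ∈ closedAdjoin a := by
    nth_rw 2 [← jeval_X a]; exact jeval_mem_closedAdjoin a _
  have hm := mul_mem_closedAdjoin a
  have hassoc := mul_assoc_closedAdjoin a
  induction n with
  | zero =>
    intro q _ hqi hq
    have hq0 : q = 0 := by
      by_contra h
      have := hCp q hqi h
      simp at hq
      linarith
    exact ⟨∅, ⟨by simp, by simp, by simp⟩, by simp [hq0], by simp⟩
  | succ n ih =>
    intro q hqA hqi hq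
    by_cases hq0 : q = 0
    · exact ⟨∅, ⟨by simp, by simp, by simp⟩, by simp [hq0], by simp⟩
    by_cases haq : a * q = 0
    · refine ⟨{q}, ⟨by simpa using hqi, by simpa using hq0, by simp⟩, by simp, ?_⟩
      simpa using ⟨hqA, 0, by rw [haq, zero_smul]⟩
    -- Using `a * q` instead of `a`, with `l ≠ 0`, forces `q * p = p`.
    obtain ⟨p, hpA, hpi, hp0, l, hl, hp⟩ := exists_idempotent_eigenvector
      (isClosed_closedAdjoin a) h1A hm hassoc (hm a haA q hqA) haq
    have hqp : q * p = p := by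
      have h2 : q * ((a * q) * p) = (a * q) * p := by
        rw [hassoc q hqA _ (hm a haA q hqA) p hpA, mul_comm a q, hassoc q hqA q hqA a haA, hqi.eq]
      rw [hp, jmul_smul] at h2
      exact smul_right_injective E hl h2
    have hap : a * p = l • p := by rw [← hp, ← hassoc a haA q hqA p hpA, hqp]
    have hpn := hCp p hpi hp0
    have hsub : q - p ∈ closedAdjoin a := Submodule.sub_mem _ hqA hpA
    obtain ⟨F, hF, hsum, hFA⟩ := ih (q - p) hsub (isIdempotentElem_sub hqi hpi hqp) (by
      rw [hpi.norm_sub_sq hqp]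
      push_cast at hq
      linarith)
    obtain ⟨hnot, hins⟩ := hF.insert hpi hp0 fun r hr => by
      rw [← hF.sum_mul hr, hsum, hassoc p hpA _ hsub r (hFA r hr).1, jmul_sub, mul_comm p q, hqp,
        hpi.eq, sub_self, jzero_mul]
    refine ⟨insert p F, hins, ?_, ?_⟩
    · rw [Finset.sum_insert hnot, hsum, add_sub_cancel]
    · exact (Finset.forall_mem_insert ..).2 ⟨⟨hpA, l, hap⟩, hFA⟩

/-- The spectral theorem. -/
theorem exists_spectral (a : E) : ∃ (F : Finset E) (l : E → ℝ), IsOrthogonalSystem F ∧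
    ∑ p ∈ F, p = 1 ∧ a = ∑ p ∈ F, l p • p := by
  obtain ⟨C, hC, hCp⟩ := exists_one_le_norm_idempotent E
  obtain ⟨n, hn⟩ := exists_nat_ge (C * ‖(1 : E)‖ ^ 2)
  obtain ⟨F, hF, hsum, hFa⟩ := exists_spectral_aux a hCp n 1
    (by rw [← jeval_one a]; exact jeval_mem_closedAdjoin a _) (mul_one 1) hn
  choose! l hl using fun p hp => (hFa p hp).2
  refine ⟨F, l, hF, hsum, ?_⟩
  rw [← Finset.sum_congr rfl hl, ← jmul_sum, hsum, mul_one]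

/-! ### Self-duality and the order -/

theorem IsOrthogonalSystem.inner_sum_smul {F : Finset E} (hF : IsOrthogonalSystem F) (l : E → ℝ)
    {q : E} (hq : q ∈ F) : inner ℝ (∑ p ∈ F, l p • p) q = l q * ‖q‖ ^ 2 := by
  rw [inner_mul_eq_inner_one, hF.sum_smul_mul l hq, inner_smul_right,
    ← real_inner_self_eq_norm_sq q, inner_mul_eq_inner_one q q, (hF.idem q hq).eq]

/-- By the Peirce identity the spectrum of multiplication by `p` lies in `{0, 1/2, 1}`, where `t =
t² + 4(t - t²)²`. A sum of squares shows positivity and also the equality case. -/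
theorem _root_.IsIdempotentElem.inner_mul_self_eq {p : E} (hp : IsIdempotentElem p) (x : E) :
    inner ℝ (p * x) x = ‖p * x‖ ^ 2 + 4 * ‖p * x - p * (p * x)‖ ^ 2 := by
  have h1 := congrArg (fun y => inner ℝ y x) (hp.peirce x)
  have h2 := congrArg (fun y => inner ℝ y x) (hp.peirce (p * x))
  simp only [inner_sub_left, inner_smul_left, inner_mul_left p, conj_trivial] at h1 h2
  rw [norm_sub_sq_real, ← real_inner_self_eq_norm_sq, ← real_inner_self_eq_norm_sq]
  simp only [inner_mul_left p]
  linarith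

theorem _root_.IsIdempotentElem.inner_nonneg {p q : E} (hp : IsIdempotentElem p)
    (hq : IsIdempotentElem q) : 0 ≤ inner ℝ p q := by
  have h : inner ℝ p q = inner ℝ (p * q) q := by
    rw [mul_comm, inner_mul_left, hq.eq]
  rw [h, hp.inner_mul_self_eq]
  positivity

theorem _root_.IsIdempotentElem.mul_eq_zero_of_inner {p q : E} (hp : IsIdempotentElem p)
    (hq : IsIdempotentElem q) (h0 : inner ℝ p q = 0) : p * q = 0 := by
  have h : inner ℝ p q = inner ℝ (p * q) q := by
    rw [mul_comm, inner_mul_left, hq.eq]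
  rw [h, hp.inner_mul_self_eq] at h0
  have h1 : ‖p * q‖ ^ 2 = 0 := by nlinarith [sq_nonneg ‖p * q‖, sq_nonneg ‖p * q - p * (p * q)‖]
  exact norm_eq_zero.1 (pow_eq_zero_iff two_ne_zero |>.1 h1)

theorem inner_nonneg_of_nonneg {a b : E} (ha : 0 ≤ a) (hb : 0 ≤ b) : 0 ≤ inner ℝ a b := by
  obtain ⟨x, rfl⟩ := (nonneg_iff a).1 ha
  obtain ⟨y, rfl⟩ := (nonneg_iff b).1 hb
  obtain ⟨F, l, hF, -, rfl⟩ := exists_spectral x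
  obtain ⟨G, m, hG, -, rfl⟩ := exists_spectral y
  rw [hF.sum_smul_mul_sum_smul, hG.sum_smul_mul_sum_smul, sum_inner]
  refine Finset.sum_nonneg fun p hp => ?_
  rw [inner_sum]
  refine Finset.sum_nonneg fun q hq => ?_
  rw [inner_smul_left, inner_smul_right]
  exact mul_nonneg (mul_self_nonneg _) (mul_nonneg (mul_self_nonneg _)
    ((hF.idem p hp).inner_nonneg (hG.idem q hq)))

theorem IsOrthogonalSystem.coeff_nonneg {F : Finset E} (hF : IsOrthogonalSystem F) {l : E → ℝ}
    {p : E} (hp : p ∈ F) (h : 0 ≤ inner ℝ (∑ p ∈ F, l p • p) p) : 0 ≤ l p := by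
  rw [hF.inner_sum_smul l hp] at h
  exact nonneg_of_mul_nonneg_left h (by have := norm_pos_iff.2 (hF.ne_zero p hp); positivity)

/-- Pairing with the spectral idempotents of `a` recovers its eigenvalues up to positive factors;
conversely, idempotents pair nonnegatively. -/
theorem nonneg_iff_inner (a : E) : 0 ≤ a ↔ ∀ b : E, 0 ≤ b → 0 ≤ inner ℝ a b := by
  refine ⟨fun ha b hb => inner_nonneg_of_nonneg ha hb, fun h => ?_⟩
  obtain ⟨F, l, hF, -, rfl⟩ := exists_spectral a
  exact hF.sum_smul_nonneg fun p hp => hF.coeff_nonneg hp (h p (hF.idem p hp).nonneg')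

theorem jadd_nonneg {a b : E} (ha : 0 ≤ a) (hb : 0 ≤ b) : 0 ≤ a + b := by
  rw [nonneg_iff_inner]
  intro c hc
  rw [inner_add_left]
  exact add_nonneg (inner_nonneg_of_nonneg ha hc) (inner_nonneg_of_nonneg hb hc)

theorem jsmul_nonneg {r : ℝ} {a : E} (hr : 0 ≤ r) (ha : 0 ≤ a) : 0 ≤ r • a := by
  rw [nonneg_iff_inner]
  intro c hc
  rw [inner_smul_left]
  exact mul_nonneg hr (inner_nonneg_of_nonneg ha hc)

theorem eq_zero_of_nonneg_of_neg_nonneg {a : E} (ha : 0 ≤ a) (ha' : 0 ≤ -a) : a = 0 := by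
  have h := inner_nonneg_of_nonneg ha ha'
  rw [inner_neg_right] at h
  have h2 := real_inner_self_nonneg (x := a)
  exact inner_self_eq_zero.1 (le_antisymm (by linarith) h2)

theorem jle_trans {a b c : E} (h1 : a ≤ b) (h2 : b ≤ c) : a ≤ c := by
  rw [le_iff_sub_nonneg] at *
  have := jadd_nonneg h2 h1
  rwa [sub_add_sub_cancel] at this

theorem jle_antisymm {a b : E} (h1 : a ≤ b) (h2 : b ≤ a) : a = b := by
  rw [le_iff_sub_nonneg] at *
  exact (sub_eq_zero.1 (eq_zero_of_nonneg_of_neg_nonneg h1 (by rwa [neg_sub]))).symm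

theorem jadd_le_add {a b c d : E} (h1 : a ≤ b) (h2 : c ≤ d) : a + c ≤ b + d := by
  rw [le_iff_sub_nonneg] at *
  have := jadd_nonneg h1 h2
  rwa [sub_add_sub_comm] at this

theorem jsmul_le_smul {r : ℝ} {a b : E} (hr : 0 ≤ r) (h : a ≤ b) : r • a ≤ r • b := by
  rw [le_iff_sub_nonneg] at *
  rw [← smul_sub]
  exact jsmul_nonneg hr h

theorem isClosed_nonneg : IsClosed {a : E | 0 ≤ a} := by
  have : {a : E | 0 ≤ a} = ⋂ b : E, ⋂ _ : 0 ≤ b, {a | 0 ≤ inner ℝ a b} := by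
    ext a
    simp [nonneg_iff_inner a]
  rw [this]
  refine isClosed_iInter fun b => isClosed_iInter fun _ => ?_
  exact isClosed_le continuous_const (by fun_prop)

theorem isClosed_jle {X : Type*} [TopologicalSpace X] {f g : X → E} (hf : Continuous f)
    (hg : Continuous g) : IsClosed {x | f x ≤ g x} := by
  have : {x | f x ≤ g x} = (fun x => g x - f x) ⁻¹' {a | 0 ≤ a} :=
    Set.ext fun x => le_iff_sub_nonneg _ _
  rw [this]
  exact isClosed_nonneg.preimage (hg.sub hf)

/-! ### The order unit norm and the JB-algebra structure -/

theorem smul_one_le_smul_one {r s : ℝ} (h : r ≤ s) : r • (1 : E) ≤ s • (1 : E) := by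
  rw [le_iff_sub_nonneg, ← sub_smul]
  exact jsmul_nonneg (sub_nonneg.2 h) one_nonneg'

theorem IsOrthogonalSystem.sum_smul_le_iff {F : Finset E} (hF : IsOrthogonalSystem F)
    (h1 : ∑ p ∈ F, p = 1) (l : E → ℝ) (r : ℝ) :
    ∑ p ∈ F, l p • p ≤ r • (1 : E) ↔ ∀ p ∈ F, l p ≤ r := by
  have h : r • (1 : E) - ∑ p ∈ F, l p • p = ∑ p ∈ F, (r - l p) • p := by
    rw [Finset.sum_congr rfl fun p _ => sub_smul r (l p) p, Finset.sum_sub_distrib,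
      ← Finset.smul_sum, h1]
  rw [le_iff_sub_nonneg, h]
  refine ⟨fun h0 p hp => ?_, fun h0 => hF.sum_smul_nonneg fun p hp => sub_nonneg.2 (h0 p hp)⟩
  exact sub_nonneg.1
    (hF.coeff_nonneg hp (inner_nonneg_of_nonneg h0 (hF.idem p hp).nonneg'))

theorem IsOrthogonalSystem.le_sum_smul_iff {F : Finset E} (hF : IsOrthogonalSystem F)
    (h1 : ∑ p ∈ F, p = 1) (l : E → ℝ) (r : ℝ) :
    -(r • (1 : E)) ≤ ∑ p ∈ F, l p • p ↔ ∀ p ∈ F, -r ≤ l p := by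
  have h := hF.sum_smul_le_iff h1 (fun p => -l p) r
  simp_rw [neg_smul, Finset.sum_neg_distrib, neg_le (a := l _)] at h
  rw [← h]
  exact ⟨fun h => by simpa using jneg_le_neg h, fun h => by simpa using jneg_le_neg h⟩

theorem mul_self_le_iff (a : E) {r : ℝ} (hr : 0 ≤ r) :
    a * a ≤ (r ^ 2) • (1 : E) ↔ -(r • (1 : E)) ≤ a ∧ a ≤ r • (1 : E) := by
  obtain ⟨F, l, hF, h1, rfl⟩ := exists_spectral a
  rw [hF.sum_smul_mul_sum_smul, hF.sum_smul_le_iff h1 fun p => l p * l p, hF.sum_smul_le_iff h1,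
    hF.le_sum_smul_iff h1, ← forall₂_and]
  refine forall₂_congr fun p _ => ?_
  rw [← abs_le, ← sq, sq_le_sq, abs_of_nonneg hr]

variable (E) in
theorem exists_le_norm_smul_one :
    ∃ D : ℝ, 0 < D ∧ ∀ a : E, -((D * ‖a‖) • (1 : E)) ≤ a ∧ a ≤ (D * ‖a‖) • (1 : E) := by
  obtain ⟨C, hC, h⟩ := exists_one_le_norm_idempotent E
  -- With `C + 1`, the bound `1 ≤ C * ‖p‖ ^ 2` yields `1 ≤ (C + 1) * ‖p‖` whether or not `‖p‖ < 1`;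
  -- Cauchy–Schwarz then bounds the eigenvalues.
  refine ⟨C + 1, by positivity, fun a => ?_⟩
  obtain ⟨F, l, hF, h1, ha⟩ := exists_spectral a
  have key : ∀ p ∈ F, |l p| ≤ (C + 1) * ‖a‖ := by
    intro p hp
    have hp0 : 0 < ‖p‖ := norm_pos_iff.2 (hF.ne_zero p hp)
    have h2 : 1 ≤ (C + 1) * ‖p‖ := by
      have := h p (hF.idem p hp) (hF.ne_zero p hp)
      by_contra! h3
      nlinarith [mul_pos hC hp0]
    have h4 : |l p| * ‖p‖ ≤ ‖a‖ := by
      have h5 := abs_real_inner_le_norm a p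
      nth_rw 1 [ha] at h5
      rw [hF.inner_sum_smul l hp, abs_mul, abs_of_nonneg (sq_nonneg ‖p‖)] at h5
      nlinarith
    nlinarith [abs_nonneg (l p)]
  rw [ha, hF.le_sum_smul_iff h1, hF.sum_smul_le_iff h1, ← ha]
  exact ⟨fun p hp => (abs_le.1 (key p hp)).1, fun p hp => (abs_le.1 (key p hp)).2⟩

omit [CompleteSpace E] [EuclideanJordanAlgebra E] in
theorem orderUnitNorm_nonneg (a : E) : 0 ≤ orderUnitNorm a :=
  Real.sInf_nonneg fun _ hr => hr.1

omit [CompleteSpace E] [EuclideanJordanAlgebra E] in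
theorem orderUnitNorm_le {a : E} {r : ℝ} (hr : 0 ≤ r) (h1 : -(r • (1 : E)) ≤ a)
    (h2 : a ≤ r • (1 : E)) : orderUnitNorm a ≤ r :=
  csInf_le ⟨0, fun _ hr => hr.1⟩ ⟨hr, h1, h2⟩

theorem orderUnitNorm_spec (a : E) :
    -(orderUnitNorm a • (1 : E)) ≤ a ∧ a ≤ orderUnitNorm a • (1 : E) := by
  obtain ⟨D, hD, h⟩ := exists_le_norm_smul_one E
  have hcl : IsClosed {r : ℝ | 0 ≤ r ∧ -(r • (1 : E)) ≤ a ∧ a ≤ r • (1 : E)} :=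
    (isClosed_le continuous_const continuous_id).inter
      ((isClosed_jle (by fun_prop) continuous_const).inter
        (isClosed_jle continuous_const (by fun_prop)))
  exact (hcl.csInf_mem ⟨D * ‖a‖, by positivity, h a⟩ ⟨0, fun _ hr => hr.1⟩).2

theorem le_orderUnitNorm (a : E) : a ≤ orderUnitNorm a • (1 : E) := (orderUnitNorm_spec a).2

theorem orderUnitNorm_le_norm {D : ℝ} (hD : 0 < D)
    (h : ∀ a : E, -((D * ‖a‖) • (1 : E)) ≤ a ∧ a ≤ (D * ‖a‖) • (1 : E)) (a : E) :
    orderUnitNorm a ≤ D * ‖a‖ :=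
  orderUnitNorm_le (by positivity) (h a).1 (h a).2

/-- With `N` the order unit norm of `a`, expand `⟨a + N1, N1 - a⟩ ≥ 0`. -/
theorem norm_le_orderUnitNorm (a : E) : ‖a‖ ≤ ‖(1 : E)‖ * orderUnitNorm a := by
  obtain ⟨h1, h2⟩ := orderUnitNorm_spec a
  rw [le_iff_sub_nonneg] at h1 h2
  have h := inner_nonneg_of_nonneg h1 h2
  rw [sub_neg_eq_add, inner_add_left, inner_sub_right, inner_sub_right,
    real_inner_self_eq_norm_sq, real_inner_self_eq_norm_sq, norm_smul, Real.norm_of_nonneg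
      (orderUnitNorm_nonneg a)] at h
  refine le_of_sq_le_sq ?_ (mul_nonneg (norm_nonneg _) (orderUnitNorm_nonneg a))
  rw [mul_comm ‖(1 : E)‖]
  linarith [real_inner_comm a (orderUnitNorm a • (1 : E))]

theorem orderUnitNorm_zero : orderUnitNorm (0 : E) = 0 :=
  le_antisymm (orderUnitNorm_le le_rfl (by simpa using jle_refl (0 : E))
    (by simpa using jle_refl (0 : E))) (orderUnitNorm_nonneg 0)

theorem orderUnitNorm_smul_le (r : ℝ) (a : E) : orderUnitNorm (r • a) ≤ |r| * orderUnitNorm a := by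
  obtain ⟨h1, h2⟩ := orderUnitNorm_spec a
  have h0 := mul_nonneg (abs_nonneg r) (orderUnitNorm_nonneg a)
  have h3 := jsmul_le_smul (abs_nonneg r) h1
  have h4 := jsmul_le_smul (abs_nonneg r) h2
  rw [smul_neg, smul_smul] at h3
  rw [smul_smul] at h4
  rcases le_total 0 r with h | h
  · rw [abs_of_nonneg h] at h0 h3 h4 ⊢
    exact orderUnitNorm_le h0 h3 h4
  · rw [abs_of_nonpos h] at h0 h3 h4 ⊢
    rw [neg_smul r a] at h3 h4
    refine orderUnitNorm_le h0 ?_ ?_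
    · simpa using jneg_le_neg h4
    · simpa using jneg_le_neg h3

theorem isNormOn_orderUnitNorm : IsNormOn (orderUnitNorm (E := E)) where
  nonneg := orderUnitNorm_nonneg
  eq_zero_iff a := by
    refine ⟨fun h => ?_, fun h => h ▸ orderUnitNorm_zero⟩
    have h1 := norm_le_orderUnitNorm a
    rw [h, mul_zero] at h1
    exact norm_le_zero_iff.1 h1
  smul r a := by
    refine le_antisymm (orderUnitNorm_smul_le r a) ?_
    rcases eq_or_ne r 0 with rfl | hr
    · simp [orderUnitNorm_zero]
    have h := orderUnitNorm_smul_le r⁻¹ (r • a)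
    rw [smul_smul, inv_mul_cancel₀ hr, one_smul, abs_inv] at h
    rwa [le_inv_mul_iff₀ (abs_pos.2 hr)] at h
  triangle a b := by
    obtain ⟨h1, h2⟩ := orderUnitNorm_spec a
    obtain ⟨h3, h4⟩ := orderUnitNorm_spec b
    refine orderUnitNorm_le (add_nonneg (orderUnitNorm_nonneg a) (orderUnitNorm_nonneg b)) ?_ ?_
    · have := jadd_le_add h1 h3
      rwa [← neg_add, ← add_smul] at this
    · have := jadd_le_add h2 h4
      rwa [← add_smul] at this

variable (E) in
theorem exists_norm_equiv : ∃ c d : ℝ, 0 < c ∧ 0 < d ∧ ∀ a : E,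
    c * ‖a‖ ≤ orderUnitNorm a ∧ orderUnitNorm a ≤ d * ‖a‖ := by
  obtain ⟨D, hD, h⟩ := exists_le_norm_smul_one E
  refine ⟨(‖(1 : E)‖ + 1)⁻¹, D, by positivity, hD, fun a => ⟨?_, orderUnitNorm_le_norm hD h a⟩⟩
  rw [inv_mul_le_iff₀ (by positivity)]
  linarith [norm_le_orderUnitNorm a, orderUnitNorm_nonneg a]

theorem isOpen_iff_orderUnitNorm (U : Set E) : IsOpen U ↔ ∀ a ∈ U, ∃ ε : ℝ, 0 < ε ∧
    ∀ b : E, orderUnitNorm (b - a) < ε → b ∈ U := by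
  obtain ⟨c, d, hc, hd, h⟩ := exists_norm_equiv E
  rw [Metric.isOpen_iff]
  refine forall₂_congr fun a _ => ⟨?_, ?_⟩
  · rintro ⟨ε, hε, hU⟩
    refine ⟨c * ε, by positivity, fun b hb => hU ?_⟩
    rw [Metric.mem_ball, dist_eq_norm]
    exact lt_of_mul_lt_mul_left ((h _).1.trans_lt hb) hc.le
  · rintro ⟨ε, hε, hU⟩
    refine ⟨ε / d, by positivity, fun b hb => hU b ((h _).2.trans_lt ?_)⟩
    rw [Metric.mem_ball, dist_eq_norm, lt_div_iff₀ hd] at hb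
    linarith

theorem isCompleteFor_orderUnitNorm : IsCompleteFor (orderUnitNorm (E := E)) := by
  obtain ⟨c, d, hc, hd, h⟩ := exists_norm_equiv E
  intro u hu
  have hcs : CauchySeq u := Metric.cauchySeq_iff.2 fun ε hε => by
    obtain ⟨K, hK⟩ := hu (c * ε) (by positivity)
    refine ⟨K, fun m hm n hn => ?_⟩
    rw [dist_eq_norm]
    exact lt_of_mul_lt_mul_left ((h _).1.trans_lt (hK m n hm hn)) hc.le
  obtain ⟨l, hl⟩ := cauchySeq_tendsto_of_complete hcs
  refine ⟨l, fun ε hε => ?_⟩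
  obtain ⟨K, hK⟩ := Metric.tendsto_atTop.1 hl (ε / d) (by positivity)
  refine ⟨K, fun n hn => (h _).2.trans_lt ?_⟩
  have := hK n hn
  rw [dist_eq_norm, lt_div_iff₀ hd] at this
  linarith

theorem orderUnitNorm_mono {a b : E} (ha : 0 ≤ a) (h : a ≤ b) :
    orderUnitNorm a ≤ orderUnitNorm b := by
  refine orderUnitNorm_le (orderUnitNorm_nonneg b) ?_ (jle_trans h (le_orderUnitNorm b))
  refine jle_trans ?_ ha
  have := jneg_le_neg (jsmul_nonneg (orderUnitNorm_nonneg b) (one_nonneg' (E := E)))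
  rwa [neg_zero] at this

theorem orderUnitNorm_mul_self (a : E) : orderUnitNorm (a * a) = orderUnitNorm a ^ 2 := by
  have h0 := orderUnitNorm_nonneg a
  refine le_antisymm ?_ ?_
  · have h := (mul_self_le_iff a h0).2 (orderUnitNorm_spec a)
    refine orderUnitNorm_le (sq_nonneg _) (jle_trans ?_ (mul_self_nonneg' a)) h
    have := jneg_le_neg (jsmul_nonneg (sq_nonneg (orderUnitNorm a)) (one_nonneg' (E := E)))
    rwa [neg_zero] at this
  · have h1 := le_orderUnitNorm (a * a)
    have h2 := orderUnitNorm_nonneg (a * a)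
    rw [← Real.sq_sqrt h2, mul_self_le_iff a (Real.sqrt_nonneg _)] at h1
    rw [← Real.sq_sqrt h2]
    exact pow_le_pow_left₀ h0 (orderUnitNorm_le (Real.sqrt_nonneg _) h1.1 h1.2) 2

theorem orderUnitNorm_mul_le_one {a b : E} (ha : orderUnitNorm a ≤ 1) (hb : orderUnitNorm b ≤ 1) :
    orderUnitNorm (a * b) ≤ 1 := by
  have hN := isNormOn_orderUnitNorm (E := E)
  have key : ∀ a b : E, orderUnitNorm a ≤ 1 → orderUnitNorm b ≤ 1 → a * b ≤ (1 : ℝ) • (1 : E) := by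
    intro a b ha hb
    have h1 : orderUnitNorm ((a + b) * (a + b)) ≤ 4 := by
      rw [orderUnitNorm_mul_self]
      nlinarith [hN.triangle a b, orderUnitNorm_nonneg (a + b)]
    have h2 := jle_trans (le_orderUnitNorm _) (smul_one_le_smul_one (E := E) h1)
    have h3 := mul_self_nonneg' (a - b)
    rw [le_iff_sub_nonneg] at h2 ⊢
    -- Polarisation: `a * b = ((a + b)² - (a - b)²) / 4`, and `(a + b)² ≤ 4`.
    have h4 := jsmul_nonneg (r := 1 / 4) (by norm_num) (jadd_nonneg h2 h3)
    convert h4 using 1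
    simp only [jmul_add, jadd_mul, jsub_mul, jmul_sub, mul_comm b a]
    module
  refine orderUnitNorm_le zero_le_one ?_ (key a b ha hb)
  have h := key (-a) b (by rwa [show orderUnitNorm (-a) = orderUnitNorm a by simpa using hN.smul (-1) a]) hb
  rw [jneg_mul] at h
  simpa using jneg_le_neg h

theorem orderUnitNorm_mul_le (a b : E) :
    orderUnitNorm (a * b) ≤ orderUnitNorm a * orderUnitNorm b := by
  have hN := isNormOn_orderUnitNorm (E := E)
  by_cases ha : orderUnitNorm a = 0
  · rw [ha, zero_mul, (hN.eq_zero_iff a).1 ha, jzero_mul, orderUnitNorm_zero]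
  by_cases hb : orderUnitNorm b = 0
  · rw [hb, mul_zero, (hN.eq_zero_iff b).1 hb, jmul_zero, orderUnitNorm_zero]
  have ha' := (orderUnitNorm_nonneg a).lt_of_ne' ha
  have hb' := (orderUnitNorm_nonneg b).lt_of_ne' hb
  have h1 : ∀ {x : E}, 0 < orderUnitNorm x → orderUnitNorm ((orderUnitNorm x)⁻¹ • x) ≤ 1 := by
    intro x hx
    rw [hN.smul, abs_inv, abs_of_pos hx, inv_mul_cancel₀ hx.ne']
  have h := orderUnitNorm_mul_le_one (h1 ha') (h1 hb')
  rw [jsmul_mul, jmul_smul, hN.smul, hN.smul, abs_inv, abs_inv, abs_of_pos ha', abs_of_pos hb',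
    inv_mul_le_iff₀ ha', inv_mul_le_iff₀ hb'] at h
  linarith

theorem isJBAlgebra_orderUnitNorm : IsJBAlgebra (orderUnitNorm (E := E)) where
  isNorm := isNormOn_orderUnitNorm
  complete := isCompleteFor_orderUnitNorm
  norm_mul_le := orderUnitNorm_mul_le
  norm_sq := orderUnitNorm_mul_self
  norm_sq_le a b := orderUnitNorm_mono (mul_self_nonneg' a) (by
    rw [le_iff_sub_nonneg, add_sub_cancel_left]
    exact mul_self_nonneg' b)

/-! ### Directed suprema, normal states and the JBW-algebra structure -/

variable (E) in
/-- On the positive cone, the Hilbert norm is controlled by the trace functional. -/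
theorem exists_norm_le_inner_one :
    ∃ D : ℝ, 0 < D ∧ ∀ a : E, 0 ≤ a → ‖a‖ ≤ D * inner ℝ 1 a := by
  obtain ⟨D, hD, h⟩ := exists_le_norm_smul_one E
  -- Pair `a ≤ D‖a‖1` with `a` and cancel `‖a‖`.
  refine ⟨D, hD, fun a ha => ?_⟩
  have h1 := (le_iff_sub_nonneg _ _).1 (h a).2
  have h2 := inner_nonneg_of_nonneg h1 ha
  rw [inner_sub_left, inner_smul_left, real_inner_self_eq_norm_sq, conj_trivial] at h2
  rcases (norm_nonneg a).eq_or_lt with h0 | h0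
  · rw [← h0]
    exact mul_nonneg hD.le (inner_nonneg_of_nonneg one_nonneg' ha)
  · refine le_of_mul_le_mul_left ?_ h0
    linarith

/-- A bounded directed set has a supremum, which lies in its closure. -/
theorem exists_isLUB_mem_closure {S : Set E} (hne : S.Nonempty) (hdir : DirectedOn (· ≤ ·) S)
    (hbdd : BddAbove S) : ∃ a, IsLUB S a ∧ a ∈ closure S := by
  obtain ⟨D, hD, hDa⟩ := exists_norm_le_inner_one E
  obtain ⟨u, hu⟩ := hbdd
  have hmono : ∀ {a b : E}, a ≤ b → inner ℝ 1 a ≤ inner ℝ 1 b := fun {a b} h => by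
    have := inner_nonneg_of_nonneg one_nonneg' ((le_iff_sub_nonneg a b).1 h)
    rw [inner_sub_right] at this
    linarith
  set f : E → ℝ := fun a => inner ℝ 1 a with hf
  have hbd : BddAbove (f '' S) := ⟨f u, by rintro _ ⟨s, hs, rfl⟩; exact hmono (hu hs)⟩
  set σ := sSup (f '' S)
  have hle : ∀ s ∈ S, f s ≤ σ := fun s hs => le_csSup hbd ⟨s, hs, rfl⟩
  -- Choose `s n` nearly maximising `⟨1, ·⟩` on `S`: any element of `S` above it is then close in
  -- norm, and directedness makes the sequence Cauchy.
  have hex : ∀ n : ℕ, ∃ s ∈ S, σ - 1 / ((n : ℝ) + 1) < f s := fun n => by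
    have h : σ - 1 / ((n : ℝ) + 1) < σ := sub_lt_self _ (by positivity)
    obtain ⟨_, ⟨s, hs, rfl⟩, h2⟩ := exists_lt_of_lt_csSup (hne.image f) h
    exact ⟨s, hs, h2⟩
  choose s hsS hs using hex
  have hnear : ∀ n, ∀ t ∈ S, s n ≤ t → ‖t - s n‖ ≤ D * (1 / ((n : ℝ) + 1)) := fun n t ht hst => by
    refine (hDa _ ((le_iff_sub_nonneg _ _).1 hst)).trans (mul_le_mul_of_nonneg_left ?_ hD.le)
    rw [inner_sub_right]
    have h1 := hs n
    have h2 := hle t ht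
    simp only [hf] at h1 h2
    linarith
  have hlim : Filter.Tendsto (fun n : ℕ => D * (1 / ((n : ℝ) + 1))) Filter.atTop (nhds 0) := by
    simpa using tendsto_one_div_add_atTop_nhds_zero_nat.const_mul D
  have hcs : CauchySeq s := Metric.cauchySeq_iff.2 fun ε hε => by
    obtain ⟨K, hK⟩ := Filter.eventually_atTop.1 (hlim.eventually (gt_mem_nhds (half_pos hε)))
    refine ⟨K, fun m hm n hn => ?_⟩
    obtain ⟨t, ht, hmt, hnt⟩ := hdir _ (hsS m) _ (hsS n)
    have h1 := (hnear m t ht hmt).trans_lt (hK m hm)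
    have h2 := (hnear n t ht hnt).trans_lt (hK n hn)
    rw [← dist_eq_norm] at h1 h2
    linarith [dist_triangle_left (s m) (s n) t]
  obtain ⟨a, ha⟩ := cauchySeq_tendsto_of_complete hcs
  refine ⟨a, ⟨fun x hx => ?_, fun v hv => ?_⟩,
    mem_closure_of_tendsto ha (Filter.Eventually.of_forall hsS)⟩
  · have hex : ∀ n, ∃ t ∈ S, x ≤ t ∧ s n ≤ t := fun n => hdir x hx _ (hsS n)
    choose t htS hxt hst using hex
    have h1 : Filter.Tendsto (fun n => t n - s n) Filter.atTop (nhds 0) :=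
      squeeze_zero_norm (fun n => hnear n _ (htS n) (hst n)) hlim
    have h2 : Filter.Tendsto t Filter.atTop (nhds a) := by
      simpa using h1.add ha
    exact (isClosed_jle (f := fun _ : E => x) continuous_const continuous_id).mem_of_tendsto h2
      (Filter.Eventually.of_forall hxt)
  · exact (isClosed_jle (g := fun _ : E => v) continuous_id continuous_const).mem_of_tendsto ha
      (Filter.Eventually.of_forall fun n => hv (hsS n))

omit [CompleteSpace E] [EuclideanJordanAlgebra E] in
theorem IsState.mono {ω : E →ₗ[ℝ] ℝ} (hω : IsState ω) {a b : E} (h : a ≤ b) : ω a ≤ ω b := by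
  have := hω.nonneg _ ((le_iff_sub_nonneg a b).1 h)
  rw [map_sub] at this
  linarith

theorem IsState.continuous {ω : E →ₗ[ℝ] ℝ} (hω : IsState ω) : Continuous ω := by
  obtain ⟨D, hD, h⟩ := exists_le_norm_smul_one E
  refine AddMonoidHomClass.continuous_of_bound ω D fun a => ?_
  have h1 := hω.mono (h a).1
  have h2 := hω.mono (h a).2
  rw [map_neg, map_smul, hω.map_one, smul_eq_mul, mul_one] at h1
  rw [map_smul, hω.map_one, smul_eq_mul, mul_one] at h2
  exact abs_le.2 ⟨h1, h2⟩

theorem IsState.isNormal {ω : E →ₗ[ℝ] ℝ} (hω : IsState ω) : IsNormal ω := by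
  intro S a hne hdir ha
  obtain ⟨b, hb, hbS⟩ := exists_isLUB_mem_closure hne hdir ⟨a, ha.1⟩
  have hab : a = b := jle_antisymm (ha.2 hb.1) (hb.2 ha.1)
  subst hab
  refine isLUB_of_mem_closure ?_ ?_
  · rintro _ ⟨s, hs, rfl⟩
    exact hω.mono (ha.1 hs)
  · exact image_closure_subset_closure_image hω.continuous ⟨a, hbS, rfl⟩

theorem isState_inner {p : E} (hp : IsIdempotentElem p) (hp0 : p ≠ 0) :
    IsState ((‖p‖ ^ 2)⁻¹ • (innerₗ E p) : E →ₗ[ℝ] ℝ) where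
  nonneg a ha := by
    have := inner_nonneg_of_nonneg hp.nonneg' ha
    simp only [LinearMap.smul_apply, innerₗ_apply_apply, smul_eq_mul]
    positivity
  map_one := by
    have h : inner ℝ p 1 = ‖p‖ ^ 2 := by
      rw [← real_inner_self_eq_norm_sq, inner_mul_eq_inner_one p p, hp.eq, real_inner_comm]
    simp only [LinearMap.smul_apply, innerₗ_apply_apply, smul_eq_mul, h]
    exact inv_mul_cancel₀ (pow_ne_zero 2 (norm_ne_zero_iff.2 hp0))

theorem exists_isState_ne {a b : E} (hab : a ≠ b) :
    ∃ ω : E →ₗ[ℝ] ℝ, IsState ω ∧ ω a ≠ ω b := by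
  obtain ⟨F, l, hF, -, h⟩ := exists_spectral (a - b)
  obtain ⟨p, hp, hlp⟩ : ∃ p ∈ F, l p ≠ 0 := by
    by_contra! h0
    refine hab (sub_eq_zero.1 ?_)
    rw [h]
    exact Finset.sum_eq_zero fun p hp => by rw [h0 p hp, zero_smul]
  refine ⟨_, isState_inner (hF.idem p hp) (hF.ne_zero p hp), fun h1 => ?_⟩
  rw [← sub_eq_zero, ← map_sub, h] at h1
  simp only [LinearMap.smul_apply, innerₗ_apply_apply, smul_eq_mul] at h1
  rw [real_inner_comm, hF.inner_sum_smul l hp] at h1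
  have := norm_ne_zero_iff.2 (hF.ne_zero p hp)
  simp_all

theorem boundedDirectedComplete : BoundedDirectedComplete E := fun _ hne hdir hbdd =>
  let ⟨a, ha, _⟩ := exists_isLUB_mem_closure hne hdir hbdd
  ⟨a, ha⟩

theorem isJBWAlgebra_orderUnitNorm : IsJBWAlgebra (orderUnitNorm (E := E)) where
  toIsJBAlgebra := isJBAlgebra_orderUnitNorm
  directedComplete := boundedDirectedComplete
  separating _ _ hab :=
    let ⟨ω, hω, h⟩ := exists_isState_ne hab
    ⟨ω, hω, hω.isNormal, h⟩

/-! ### Atomic idempotents and finite rank -/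

omit [CompleteSpace E] [EuclideanJordanAlgebra E] in
theorem isIdempotentElem_one_sub {p : E} (hp : IsIdempotentElem p) :
    IsIdempotentElem (1 - p) :=
  isIdempotentElem_sub (mul_one 1) hp (one_mul p)

/-- Pairing `1 - p` with `p - q` gives `⟨1 - p, q⟩ ≤ 0`, and idempotents with zero inner product are
orthogonal. -/
theorem _root_.IsIdempotentElem.mul_eq_of_le {p q : E} (hp : IsIdempotentElem p)
    (hq : IsIdempotentElem q) (h : q ≤ p) : p * q = q := by
  have h0 := inner_nonneg_of_nonneg (isIdempotentElem_one_sub hp).nonneg' ((le_iff_sub_nonneg q p).1 h)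
  have h1 := (isIdempotentElem_one_sub hp).inner_nonneg hq
  have h2 : inner ℝ (1 - p) p = 0 := by
    rw [inner_mul_eq_inner_one, jsub_mul, one_mul, hp.eq, sub_self, inner_zero_right]
  rw [inner_sub_right, h2] at h0
  have h3 := (isIdempotentElem_one_sub hp).mul_eq_zero_of_inner hq (by linarith)
  rw [jsub_mul, one_mul] at h3
  exact (sub_eq_zero.1 h3).symm

theorem exists_isAtomic_aux {C : ℝ}
    (hCp : ∀ p : E, IsIdempotentElem p → p ≠ 0 → 1 ≤ C * ‖p‖ ^ 2) (n : ℕ) :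
    ∀ p : E, IsIdempotentElem p → p ≠ 0 → C * ‖p‖ ^ 2 ≤ n → ∃ q : E, IsAtomic q ∧ q ≤ p := by
  induction n with
  | zero =>
    intro p hp hp0 h
    have := hCp p hp hp0
    simp at h
    linarith
  | succ n ih =>
    intro p hp hp0 h
    by_cases hat : IsAtomic p
    · exact ⟨p, hat, jle_refl p⟩
    have : ∃ q : E, IsIdempotentElem q ∧ q ≠ 0 ∧ q ≤ p ∧ q ≠ p := by
      by_contra! h1
      exact hat ⟨hp, hp0, h1⟩
    obtain ⟨q, hq, hq0, hqp, hne⟩ := this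
    have hpq := hp.mul_eq_of_le hq hqp
    have h1 := hCp _ (isIdempotentElem_sub hp hq hpq) (sub_ne_zero.2 hne.symm)
    rw [hq.norm_sub_sq hpq] at h1
    push_cast at h
    obtain ⟨r, hr, hrq⟩ := ih q hq hq0 (by linarith)
    exact ⟨r, hr, jle_trans hrq hqp⟩

theorem isTypeI : IsTypeI E := by
  obtain ⟨C, hC, hCp⟩ := exists_one_le_norm_idempotent E
  intro p hp hp0
  obtain ⟨n, hn⟩ := exists_nat_ge (C * ‖p‖ ^ 2)
  exact exists_isAtomic_aux hCp n p hp hp0 hn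

theorem IsOrthogonalSystem.norm_sum_sq {F : Finset E} (hF : IsOrthogonalSystem F) :
    ‖∑ p ∈ F, p‖ ^ 2 = ∑ p ∈ F, ‖p‖ ^ 2 := by
  rw [← real_inner_self_eq_norm_sq, inner_sum]
  refine Finset.sum_congr rfl fun p hp => ?_
  simpa using hF.inner_sum_smul (fun _ => 1) hp

theorem hasFiniteRank : HasFiniteRank E := by
  obtain ⟨C, hC, hCp⟩ := exists_one_le_norm_idempotent E
  obtain ⟨N, hN⟩ := exists_nat_ge (C * ‖(1 : E)‖ ^ 2)
  refine ⟨N, fun F hF horth => ?_⟩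
  have hF' : IsOrthogonalSystem F := ⟨fun p hp => (hF p hp).1, fun p hp => (hF p hp).2, horth⟩
  have h1 := hF'.isIdempotentElem_sum.norm_sub_sq (one_mul _)
  have h2 : (F.card : ℝ) ≤ ∑ p ∈ F, C * ‖p‖ ^ 2 := by
    have := Finset.card_nsmul_le_sum F (fun p => C * ‖p‖ ^ 2) 1
      fun p hp => hCp p (hF p hp).1 (hF p hp).2
    simpa using this
  rw [← Finset.mul_sum, ← hF'.norm_sum_sq] at h2
  have h3 : ‖∑ p ∈ F, p‖ ^ 2 ≤ ‖(1 : E)‖ ^ 2 := by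
    linarith [sq_nonneg ‖1 - ∑ p ∈ F, p‖]
  exact_mod_cast h2.trans ((mul_le_mul_of_nonneg_left h3 hC.le).trans hN)

theorem exists_sum_isAtomic_aux {C : ℝ}
    (hCp : ∀ p : E, IsIdempotentElem p → p ≠ 0 → 1 ≤ C * ‖p‖ ^ 2) (n : ℕ) :
    ∀ p : E, IsIdempotentElem p → C * ‖p‖ ^ 2 ≤ n →
      ∃ F : Finset E, IsOrthogonalSystem F ∧ (∀ q ∈ F, IsAtomic q) ∧ ∑ q ∈ F, q = p := by
  classical
  induction n with
  | zero =>
    intro p hp h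
    have hp0 : p = 0 := by
      by_contra hp0
      have := hCp p hp hp0
      simp at h
      linarith
    exact ⟨∅, ⟨by simp, by simp, by simp⟩, by simp, by simp [hp0]⟩
  | succ n ih =>
    intro p hp h
    by_cases hp0 : p = 0
    · exact ⟨∅, ⟨by simp, by simp, by simp⟩, by simp, by simp [hp0]⟩
    obtain ⟨q, hq, hqp⟩ := isTypeI p hp hp0
    have hpq := hp.mul_eq_of_le hq.idem hqp
    have hsub := isIdempotentElem_sub hp hq.idem hpq
    have hqn := hCp q hq.idem hq.ne_zero
    obtain ⟨F, hF, hFat, hsum⟩ := ih (p - q) hsub (by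
      rw [hq.idem.norm_sub_sq hpq]
      push_cast at h
      linarith)
    have hinner : inner ℝ (p - q) q = 0 := by
      rw [inner_mul_eq_inner_one, jsub_mul, hpq, hq.idem.eq, sub_self, inner_zero_right]
    -- The nonnegative numbers `⟨r, q⟩` sum to zero, so each vanishes; this gives orthogonality
    -- without associativity.
    rw [← hsum, sum_inner, Finset.sum_eq_zero_iff_of_nonneg
      fun r hr => (hF.idem r hr).inner_nonneg hq.idem] at hinner
    obtain ⟨hnot, hins⟩ := hF.insert hq.idem hq.ne_zero fun r hr => by
      rw [mul_comm]
      exact (hF.idem r hr).mul_eq_zero_of_inner hq.idem (hinner r hr)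
    refine ⟨insert q F, hins, (Finset.forall_mem_insert ..).2 ⟨hq, hFat⟩, ?_⟩
    rw [Finset.sum_insert hnot, hsum, add_sub_cancel]

variable (E) in
theorem exists_sum_isAtomic_eq_one : ∃ F : Finset E, (∀ p ∈ F, IsAtomic p) ∧
    (∀ p ∈ F, ∀ q ∈ F, p ≠ q → p * q = 0) ∧ ∑ p ∈ F, p = 1 := by
  obtain ⟨C, hC, hCp⟩ := exists_one_le_norm_idempotent E
  obtain ⟨n, hn⟩ := exists_nat_ge (C * ‖(1 : E)‖ ^ 2)
  obtain ⟨F, hF, hat, hsum⟩ := exists_sum_isAtomic_aux hCp n 1 (mul_one 1) hn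
  exact ⟨F, hat, hF.orth, hsum⟩

theorem exists_nat_bound (a : E) :
    ∃ n : ℕ, -((n : ℝ) • (1 : E)) ≤ a ∧ a ≤ (n : ℝ) • (1 : E) := by
  obtain ⟨n, hn⟩ := exists_nat_ge (orderUnitNorm a)
  obtain ⟨h1, h2⟩ := orderUnitNorm_spec a
  exact ⟨n, jle_trans (jneg_le_neg (smul_one_le_smul_one hn)) h1,
    jle_trans h2 (smul_one_le_smul_one hn)⟩

theorem le_zero_of_forall_le {a : E} (h : ∀ n : ℕ, n ≠ 0 → a ≤ (1 / (n : ℝ)) • (1 : E)) :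
    a ≤ 0 := by
  have hcl : IsClosed {r : ℝ | a ≤ r • (1 : E)} :=
    isClosed_jle continuous_const (by fun_prop)
  have h0 := hcl.mem_of_tendsto tendsto_one_div_add_atTop_nhds_zero_nat
    (Filter.Eventually.of_forall fun n => by
      simpa using h (n + 1) (Nat.succ_ne_zero n))
  simpa using h0

end Hilbert

end RealJordanAlgebra

theorem mainTheorem9 {E : Type*} [NormedAddCommGroup E] [InnerProductSpace ℝ E]
    [CompleteSpace E] [RealJordanAlgebra E] [EuclideanJordanAlgebra E] :
    -- the positive elements form a cone, and `≤` is a partial order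
    ((∀ a b : E, 0 ≤ a → 0 ≤ b → 0 ≤ a + b) ∧
      (∀ (r : ℝ) (a : E), 0 ≤ r → 0 ≤ a → 0 ≤ r • a) ∧
      (∀ a : E, 0 ≤ a → 0 ≤ -a → a = 0) ∧
      (∀ a : E, a ≤ a) ∧ (∀ a b c : E, a ≤ b → b ≤ c → a ≤ c) ∧
      (∀ a b : E, a ≤ b → b ≤ a → a = b)) ∧
    -- `1` is a strong Archimedean unit
    ((∀ a : E, ∃ n : ℕ, -((n : ℝ) • (1 : E)) ≤ a ∧ a ≤ (n : ℝ) • (1 : E)) ∧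
      (∀ a : E, (∀ n : ℕ, n ≠ 0 → a ≤ (1 / (n : ℝ)) • (1 : E)) → a ≤ 0)) ∧
    -- the order unit norm is a norm, and `a ≤ ‖a‖ 1`
    (RealJordanAlgebra.IsNormOn (RealJordanAlgebra.orderUnitNorm (E := E)) ∧
      (∀ a : E, a ≤ RealJordanAlgebra.orderUnitNorm a • (1 : E))) ∧
    -- it is equivalent to the Hilbert norm, induces the same topology, and is complete
    ((∃ c d : ℝ, 0 < c ∧ 0 < d ∧ ∀ a : E,
        c * ‖a‖ ≤ RealJordanAlgebra.orderUnitNorm a ∧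
        RealJordanAlgebra.orderUnitNorm a ≤ d * ‖a‖) ∧
      (∀ U : Set E, IsOpen U ↔ ∀ a ∈ U, ∃ ε : ℝ, 0 < ε ∧
        ∀ b : E, RealJordanAlgebra.orderUnitNorm (b - a) < ε → b ∈ U) ∧
      RealJordanAlgebra.IsCompleteFor (RealJordanAlgebra.orderUnitNorm (E := E))) ∧
    -- self-duality of the cone
    (∀ a : E, 0 ≤ a ↔ ∀ b : E, 0 ≤ b → 0 ≤ inner ℝ a b) ∧
    -- bounded directed completeness, normality of all states, JBW-algebra
    (RealJordanAlgebra.BoundedDirectedComplete E ∧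
      (∀ ω : E →ₗ[ℝ] ℝ, RealJordanAlgebra.IsState ω → RealJordanAlgebra.IsNormal ω) ∧
      RealJordanAlgebra.IsJBWAlgebra (RealJordanAlgebra.orderUnitNorm (E := E))) ∧
    -- type I and finite rank
    (RealJordanAlgebra.IsTypeI E ∧ RealJordanAlgebra.HasFiniteRank E ∧
      (∃ F : Finset E, (∀ p ∈ F, RealJordanAlgebra.IsAtomic p) ∧
        (∀ p ∈ F, ∀ q ∈ F, p ≠ q → p * q = 0) ∧ ∑ p ∈ F, p = 1)) := by
  open RealJordanAlgebra in
  exact ⟨⟨fun _ _ => jadd_nonneg, fun _ _ => jsmul_nonneg,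
      fun _ => eq_zero_of_nonneg_of_neg_nonneg, jle_refl, fun _ _ _ => jle_trans,
      fun _ _ => jle_antisymm⟩,
    ⟨exists_nat_bound, fun _ => le_zero_of_forall_le⟩,
    ⟨isNormOn_orderUnitNorm, le_orderUnitNorm⟩,
    ⟨exists_norm_equiv E, isOpen_iff_orderUnitNorm, isCompleteFor_orderUnitNorm⟩,
    nonneg_iff_inner,
    ⟨boundedDirectedComplete, fun _ => IsState.isNormal, isJBWAlgebra_orderUnitNorm⟩,
    ⟨isTypeI, hasFiniteRank, exists_sum_isAtomic_eq_one E⟩⟩
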